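/- There is an absolute constant $C>0$ such that the following holds. Let $n\ge 1$, let $Z$ be a centered random vector in $\mathbb{R}^d$ with covariance matrix $\Sigma=\mathbb{E}(ZZ^{\mathsf T})$ and sub-exponential marginals, i.e., for some $\eta\ge 1$, $$\left(\mathbb{E}\,|\langle u,Z\rangle|^p\right)^{1/p}\le \eta\,p\,\|u\|_\Sigma\qquad\text{for all } u\in\mathbb{R}^d \text{ and all real } p\ge 1,$$ where $\|u\|_\Sigma=\sqrt{u^{\mathsf T}\Sigma u}$. Let $Z_1,\dots,Z_n$ be independent copies of $Z$, and let $r=\operatorname{tr}(\Sigma)/\|\Sigma\|_{\mathrm{op}}$ be the effective rank of $\Sigma$ (with $r=0$ if $\Sigma=0$). Then for every $t\ge 0$, with probability at least $1-e^{-t}$, $$\left\|\frac1n\sum_{i=1}^n Z_iZ_i^{\mathsf T}-\Sigma\right\|_{\mathrm{op}}\le \begin{cases} C\,\eta^2\,\|\Sigma\|_{\mathrm{op}}\max\left\{\dfrac{(r+t+\log 8)^2}{n},\ \left(\dfrac{r+t+\log 8}{n}\right)^{1/2}\right\}, & \text{if } r\le n^{1/3},\\[2ex] C\,\eta^2\,\|\Sigma\|_{\mathrm{op}}\max\left\{\dfrac{(n^{1/3}+t+\log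 8)^2}{n},\ \dfrac{r\,(n^{1/3}+t+\log 8)}{n}\right\}, & \text{if } r> n^{1/3}.\end{cases}$$ -/

import Mathlib

open MeasureTheory ProbabilityTheory

/-- The operator norm of a real square matrix, as a map of the Euclidean space `ℝᵈ`. -/
noncomputable def opNorm {d : ℕ} (A : Matrix (Fin d) (Fin d) ℝ) : ℝ :=
  ‖Matrix.toEuclideanCLM (𝕜 := ℝ) A‖

/-- `‖u‖_M = √(uᵀ M u)`. -/
noncomputable def matrixNorm {d : ℕ} (M : Matrix (Fin d) (Fin d) ℝ)
    (u : EuclideanSpace ℝ (Fin d)) : ℝ :=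
  Real.sqrt (dotProduct u.ofLp (M.mulVec u.ofLp))

/-- The effective rank `tr M / ‖M‖_op` (equal to `0` for `M = 0`). -/
noncomputable def effectiveRank {d : ℕ} (M : Matrix (Fin d) (Fin d) ℝ) : ℝ :=
  M.trace / opNorm M

/-- The matrix `E (Z Zᵀ)`, which is the covariance matrix of `Z` when `Z` is centered. -/
noncomputable def secondMomentMatrix {d : ℕ} {Ω : Type*} [MeasurableSpace Ω]
    (μ : Measure Ω) (Z : Ω → EuclideanSpace ℝ (Fin d)) : Matrix (Fin d) (Fin d) ℝ :=
  Matrix.of fun i j => ∫ ω, Z ω i * Z ω j ∂μ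

/-- The sample covariance matrix `(1/n) ∑ᵢ zᵢ zᵢᵀ`. -/
noncomputable def sampleCovariance {d n : ℕ} (z : Fin n → EuclideanSpace ℝ (Fin d)) :
    Matrix (Fin d) (Fin d) ℝ :=
  (1 / (n : ℝ)) • ∑ i, Matrix.vecMulVec (z i).ofLp (z i).ofLp

/-- Sub-exponential marginals with parameter `η`: `(E |⟨u, Z⟩|^p)^(1/p) ≤ η p ‖u‖_Σ`, with
`Σ = E (Z Zᵀ)`, for all `u` and all real `p ≥ 1`. The left side is the extended-real-valued
`Lᵖ` seminorm, so the finiteness of all moments is part of the condition. -/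
def HasSubexponentialMarginals {d : ℕ} {Ω : Type*} [MeasurableSpace Ω]
    (μ : Measure Ω) (Z : Ω → EuclideanSpace ℝ (Fin d)) (η : ℝ) : Prop :=
  ∀ (u : EuclideanSpace ℝ (Fin d)) (p : ℝ), 1 ≤ p →
    eLpNorm (fun ω => inner ℝ u (Z ω)) (ENNReal.ofReal p) μ ≤
      ENNReal.ofReal (η * p * matrixNorm (secondMomentMatrix μ Z) u)

open scoped Nat


/-! The argument is a moment method in which the supremum over directions is replaced by a Gaussian
average. If `g`, `g'` are independent standard Gaussian vectors, the `2m`-th moment of `⟨g, A g'⟩`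
is at least `(m! ‖A‖ ^ m) ^ 2` (`ofReal_opNorm_pow_le_lintegral_stdGaussian`). Applied to the
covariance error, Tonelli puts the expectation over the sample inside, at a fixed pair `u`, `v`.

There the form is a sum of i.i.d. centered products of marginals, whose `a`-th moments grow like
`(η² a²) ^ a`. This growth is too fast for an exponential moment, so the generating functions are
truncated at order `2m` (`abs_integral_sum_pow_le`, `sum_range_moment_le`). The resulting bound
carries a factor `(m!) ^ 2`, which the Gaussian lower bound cancels. The remaining Gaussian moments
of `‖g‖_Σ` cost `tr Σ + m ‖Σ‖` (`lintegral_matrixNorm_pow_stdGaussian`).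

Markov's inequality at an order comparable to `s` gives, up to constants, the error `η² ‖Σ‖ (r +
s)(s + √(n/s)) / n` outside probability `e^(-s)`. The two regimes are two choices of `s`. -/

/-- Moments of a sum of independent variables, bounded through truncated exponential
generating functions of the moments of the summands. -/
lemma abs_integral_sum_pow_le {ι Ω : Type*} [MeasurableSpace Ω] {μ : Measure Ω}
    [IsProbabilityMeasure μ] {X : ι → Ω → ℝ} (hind : iIndepFun X μ)
    (hint : ∀ i (k : ℕ), Integrable (fun ω => X i ω ^ k) μ) {N : ι → ℕ → ℝ}
    (hN0 : ∀ i a, 0 ≤ N i a) {c : ℝ} (hc : 0 ≤ c)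
    (hN : ∀ i a, |∫ ω, X i ω ^ a ∂μ| ≤ c ^ a * N i a) {l : ℝ} (hl : 0 < l) (p : ℕ) (s : Finset ι) :
    (∀ k : ℕ, Integrable (fun ω => (∑ i ∈ s, X i ω) ^ k) μ) ∧
    ∀ k ≤ p, |∫ ω, (∑ i ∈ s, X i ω) ^ k ∂μ| ≤ c ^ k * (k.factorial / l ^ k) *
      ∏ i ∈ s, ∑ a ∈ Finset.range (p + 1), N i a * l ^ a / a.factorial := by
  classical
  have hmeas : ∀ i, AEMeasurable (X i) μ := fun i => by
    simpa using (hint i 1).aestronglyMeasurable.aemeasurable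
  induction s using Finset.induction_on with
  | empty =>
    refine ⟨fun k => by simp, fun k _ => ?_⟩
    rcases Nat.eq_zero_or_pos k with rfl | hk
    · simp
    · simp only [Finset.sum_empty, Finset.prod_empty, mul_one, zero_pow hk.ne', integral_zero,
        abs_zero]
      positivity
  | insert j s hj ih =>
    obtain ⟨ihI, ihB⟩ := ih
    have hjs : IndepFun (X j) (fun ω => ∑ i ∈ s, X i ω) μ := by
      have := (hind.indepFun_finsetSum_of_notMem₀ hmeas hj).symm
      refine this.congr Filter.EventuallyEq.rfl (Filter.Eventually.of_forall fun ω => ?_)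
      simp
    have hpow : ∀ a b : ℕ, IndepFun (fun ω => X j ω ^ a) (fun ω => (∑ i ∈ s, X i ω) ^ b) μ :=
      fun a b => hjs.comp (measurable_id.pow_const a) (measurable_id.pow_const b)
    have hprod : ∀ a b : ℕ, Integrable (fun ω => X j ω ^ a * (∑ i ∈ s, X i ω) ^ b) μ :=
      fun a b => (hpow a b).integrable_mul (hint j a) (ihI b)
    have hexp : ∀ (k : ℕ) ω, (∑ i ∈ insert j s, X i ω) ^ k = ∑ a ∈ Finset.range (k + 1),
        X j ω ^ a * (∑ i ∈ s, X i ω) ^ (k - a) * (k.choose a : ℝ) := fun k ω => by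
      rw [Finset.sum_insert hj, add_pow]
    simp_rw [hexp]
    refine ⟨fun k => integrable_finsetSum _ fun a _ => (hprod a _).mul_const _, fun k hk => ?_⟩
    rw [integral_finsetSum _ fun a _ => (hprod a _).mul_const _, Finset.prod_insert hj]
    set P := ∏ i ∈ s, ∑ a ∈ Finset.range (p + 1), N i a * l ^ a / a.factorial with hP
    have hP0 : 0 ≤ P := Finset.prod_nonneg fun i _ => Finset.sum_nonneg fun a _ => by
      have := hN0 i a
      positivity
    calc |∑ a ∈ Finset.range (k + 1), ∫ ω, X j ω ^ a * (∑ i ∈ s, X i ω) ^ (k - a) *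
            (k.choose a : ℝ) ∂μ|
        ≤ ∑ a ∈ Finset.range (k + 1), c ^ k * (k.factorial / l ^ k) * P *
            (N j a * l ^ a / a.factorial) := by
          -- The binomial coefficient times `a! (k - a)!` is `k!`, so dividing moments by factorials
          -- turns the binomial expansion into a product of generating functions.
          refine (Finset.abs_sum_le_sum_abs _ _).trans (Finset.sum_le_sum fun a ha => ?_)
          have hak : a ≤ k := Nat.lt_succ_iff.mp (Finset.mem_range.mp ha)
          rw [integral_mul_const, (hpow a (k - a)).integral_fun_mul_eq_mul_integral
            (hint j a).aestronglyMeasurable (ihI _).aestronglyMeasurable, abs_mul, abs_mul,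
            Nat.abs_cast]
          calc _ ≤ c ^ a * N j a * (c ^ (k - a) * ((k - a).factorial / l ^ (k - a)) * P) *
                  (k.choose a : ℝ) := by
                gcongr
                · exact mul_nonneg (pow_nonneg hc _) (hN0 j a)
                · exact hN j a
                · exact ihB _ (by omega)
            _ = _ := by
                rw [← Nat.choose_mul_factorial_mul_factorial hak]
                have : l ^ k = l ^ (k - a) * l ^ a := by rw [← pow_add]; congr 1; omega
                have hck : c ^ k = c ^ (k - a) * c ^ a := by rw [← pow_add]; congr 1; omega
                rw [this, hck]
                push_cast
                field_simp
      _ ≤ ∑ a ∈ Finset.range (p + 1), c ^ k * (k.factorial / l ^ k) * P *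
            (N j a * l ^ a / a.factorial) := by
          -- Extending the sum to `p` makes the new factor independent of `k`, as the induction
          -- needs.
          refine Finset.sum_le_sum_of_subset_of_nonneg
            (Finset.range_mono (by omega)) fun a _ _ => ?_
          have := hN0 j a
          positivity
      _ = _ := by rw [← Finset.mul_sum]; ring

/-! ### Gaussian moments -/

lemma factorial_le_doubleFactorial_two_mul_sub_one (m : ℕ) : m ! ≤ (2 * m - 1)‼ := by
  induction m with
  | zero => simp
  | succ m ih =>
    -- Truncated subtraction makes `2 * 0 - 1 = 0`, so the recursion fails at `m = 0`.
    have h : 2 * (m + 1) - 1 = (2 * m - 1) + 2 ∨ m = 0 := by omega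
    rcases h with h | rfl
    · rw [h, Nat.doubleFactorial_add_two, Nat.factorial_succ]
      exact Nat.mul_le_mul (by omega) ih
    · simp

lemma doubleFactorial_two_mul_sub_one_le (m : ℕ) : (2 * m - 1)‼ ≤ 2 ^ m * m ! := by
  induction m with
  | zero => simp
  | succ m ih =>
    have h : 2 * (m + 1) - 1 = (2 * m - 1) + 2 ∨ m = 0 := by omega
    rcases h with h | rfl
    · rw [h, Nat.doubleFactorial_add_two, Nat.factorial_succ, pow_succ]
      calc _ ≤ (2 * (m + 1)) * (2 ^ m * m !) := Nat.mul_le_mul (by omega) ih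
        _ = _ := by ring
    · simp

lemma integrable_pow_gaussianReal (k : ℕ) :
    Integrable (fun x : ℝ => x ^ k) (gaussianReal 0 1) := by
  refine (integrable_norm_iff (by fun_prop)).1 ?_
  simp_rw [norm_pow]
  simpa using (memLp_id_gaussianReal (μ := 0) (v := 1) (k : NNReal)).integrable_norm_pow'

/-- Folding the density onto the half-line gives a Gamma value at a half-integer. -/
lemma integral_pow_two_mul_gaussianReal (m : ℕ) :
    ∫ x : ℝ, x ^ (2 * m) ∂gaussianReal 0 1 = (2 * m - 1)‼ := by
  rw [integral_gaussianReal_eq_integral_smul one_ne_zero]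
  have h1 : ∀ x : ℝ, gaussianPDFReal 0 1 x • x ^ (2 * m) =
      (√(2 * Real.pi))⁻¹ * ((fun y : ℝ => y ^ (2 * m : ℝ) * Real.exp (-(1 / 2) * y ^ (2 : ℝ))) |x|) := by
    intro x
    have : |x| ^ (2 * m : ℝ) = x ^ (2 * m) := by
      rw [show (2 * m : ℝ) = ((2 * m : ℕ) : ℝ) by push_cast; ring, Real.rpow_natCast,
        pow_mul, pow_mul, sq_abs]
    simp only [gaussianPDFReal, this, smul_eq_mul, Real.rpow_two, sq_abs]
    simp only [NNReal.coe_one, mul_one, sub_zero]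
    rw [show -x ^ 2 / 2 = -(1 / 2) * x ^ 2 by ring]
    ring
  simp_rw [h1]
  rw [integral_const_mul, integral_comp_abs
    (f := fun y : ℝ => y ^ (2 * m : ℝ) * Real.exp (-(1 / 2) * y ^ (2 : ℝ))),
    integral_rpow_mul_exp_neg_mul_rpow (by norm_num)
    (lt_of_lt_of_le (by norm_num) (by positivity : (0 : ℝ) ≤ 2 * m)) (by norm_num)]
  rw [show (2 * m + 1 : ℝ) / 2 = m + 1 / 2 by ring, Real.Gamma_nat_add_half,
    show -(2 * m + 1 : ℝ) / 2 = -(m + 1 / 2) by ring, one_div, Real.inv_rpow (by norm_num),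
    Real.rpow_neg (by norm_num), inv_inv, Real.rpow_add (by norm_num), Real.rpow_natCast,
    show (2 : ℝ) ^ (2 : ℝ)⁻¹ = √2 by rw [Real.sqrt_eq_rpow, one_div], Real.sqrt_mul (by norm_num)]
  have := Real.sqrt_pos.2 Real.pi_pos
  have : (0 : ℝ) < √2 := by positivity
  field_simp

section StdGaussian

variable {E : Type*} [NormedAddCommGroup E] [InnerProductSpace ℝ E] [FiniteDimensional ℝ E]
  [MeasurableSpace E] [BorelSpace E]

lemma map_inner_stdGaussian (v : E) :
    (stdGaussian E).map (fun x => inner ℝ v x) = (gaussianReal 0 1).map (fun y => ‖v‖ * y) := by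
  have hL : (fun x => inner ℝ v x) = ⇑(innerSL ℝ v) := by ext; simp
  rw [hL, IsGaussian.map_eq_gaussianReal, integral_strongDual_stdGaussian,
    variance_dual_stdGaussian, gaussianReal_map_const_mul]
  congr 1
  · simp
  · ext; simp

lemma integrable_inner_pow_stdGaussian (v : E) (k : ℕ) :
    Integrable (fun x => inner ℝ v x ^ k) (stdGaussian E) := by
  have hk : Continuous fun y : ℝ => y ^ k := continuous_pow k
  have h : Integrable (fun y : ℝ => y ^ k) ((stdGaussian E).map (fun x => inner ℝ v x)) := by
    rw [map_inner_stdGaussian,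
      integrable_map_measure hk.aestronglyMeasurable (by fun_prop)]
    simpa [Function.comp_def, mul_pow] using (integrable_pow_gaussianReal k).const_mul (‖v‖ ^ k)
  exact (integrable_map_measure hk.aestronglyMeasurable (by fun_prop)).1 h

lemma integral_inner_pow_stdGaussian (v : E) (m : ℕ) :
    ∫ x, inner ℝ v x ^ (2 * m) ∂stdGaussian E = ‖v‖ ^ (2 * m) * (2 * m - 1)‼ := by
  have hk : Continuous fun y : ℝ => y ^ (2 * m) := continuous_pow _
  have h := integral_map (by fun_prop : AEMeasurable (fun x => inner ℝ v x) (stdGaussian E))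
    (f := fun y : ℝ => y ^ (2 * m)) hk.aestronglyMeasurable
  rw [← h, map_inner_stdGaussian, integral_map (by fun_prop) hk.aestronglyMeasurable]
  simp_rw [mul_pow]
  rw [integral_const_mul, integral_pow_two_mul_gaussianReal]

/-- The averaging over directions is done with values in `ENNReal`, where exchanging integrals
requires measurability only. -/
lemma lintegral_inner_pow_stdGaussian (v : E) (m : ℕ) :
    ∫⁻ x, ENNReal.ofReal (inner ℝ v x ^ (2 * m)) ∂stdGaussian E =
      ENNReal.ofReal (‖v‖ ^ (2 * m) * (2 * m - 1)‼) := by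
  rw [← integral_inner_pow_stdGaussian, ofReal_integral_eq_lintegral_ofReal
    (integrable_inner_pow_stdGaussian v _)
    (Filter.Eventually.of_forall fun x => (even_two_mul m).pow_nonneg _)]

end StdGaussian

/-- Moments of a weighted sum of squares of independent standard Gaussian variables. -/
lemma lintegral_weighted_sq_pow_pi_gaussianReal {ι : Type*} [Fintype ι] (c : ι → ℝ) {τ : ℝ}
    (hc : ∀ i, 0 ≤ c i) (hcτ : ∀ i, c i ≤ τ) (hτ : 0 < τ) {m : ℕ} (hm : 1 ≤ m) :
    ∫⁻ x : ι → ℝ, ENNReal.ofReal ((∑ i, c i * x i ^ 2) ^ m)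
        ∂(Measure.pi fun _ => gaussianReal 0 1) ≤
      ENNReal.ofReal ((4 * Real.exp 1 * (∑ i, c i + m * τ)) ^ m) := by
  have hm0 : (0 : ℝ) < m := by exact_mod_cast hm
  have hT : 0 ≤ ∑ i, c i := Finset.sum_nonneg fun i _ => hc i
  set T := ∑ i, c i with hTdef
  set P : Measure (ι → ℝ) := Measure.pi fun _ => gaussianReal 0 1 with hP
  have hmp : ∀ i, MeasurePreserving (Function.eval i) P (gaussianReal 0 1) :=
    fun i => measurePreserving_eval _ i
  have hind : iIndepFun (fun i (x : ι → ℝ) => c i * x i ^ 2) P :=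
    iIndepFun_pi (X := fun i (y : ℝ) => c i * y ^ 2) fun i => by fun_prop
  have hint : ∀ i (k : ℕ), Integrable (fun x : ι → ℝ => (c i * x i ^ 2) ^ k) P := fun i k => by
    simp_rw [mul_pow, ← pow_mul]
    exact ((hmp i).integrable_comp_of_integrable (integrable_pow_gaussianReal (2 * k))).const_mul _
  have hN : ∀ i k, |∫ x : ι → ℝ, (c i * x i ^ 2) ^ k ∂P| ≤ (2 * c i) ^ k * k ! := fun i k => by
    simp_rw [mul_pow, ← pow_mul]
    have hk : Continuous fun y : ℝ => y ^ (2 * k) := continuous_pow _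
    have h := integral_map (μ := P) (hmp i).measurable.aemeasurable (f := fun y : ℝ => y ^ (2 * k))
      hk.aestronglyMeasurable
    rw [(hmp i).map_eq, integral_pow_two_mul_gaussianReal] at h
    have hck := pow_nonneg (hc i) k
    rw [integral_const_mul, ← h, abs_mul, abs_of_nonneg hck, Nat.abs_cast, mul_comm (2 ^ k : ℝ),
      mul_assoc]
    gcongr
    exact_mod_cast doubleFactorial_two_mul_sub_one_le k
  -- This choice gives `2 c_i l ≤ 1/2`, so each geometric series converges, and `4 l T ≤ m`, so the
  -- product is at most `e^m`.
  set l : ℝ := m / (4 * (T + m * τ)) with hl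
  have hl0 : 0 < l := by positivity
  obtain ⟨hI, hB⟩ := abs_integral_sum_pow_le hind hint (N := fun i a => (2 * c i) ^ a * (a ! : ℝ))
    (fun i a => by have := hc i; positivity) zero_le_one (by simpa using hN) hl0 m Finset.univ
  rw [← ofReal_integral_eq_lintegral_ofReal (hI m)
    (Filter.Eventually.of_forall fun x => pow_nonneg (Finset.sum_nonneg fun i _ =>
      mul_nonneg (hc i) (sq_nonneg _)) _)]
  refine ENNReal.ofReal_le_ofReal ((le_abs_self _).trans ((hB m le_rfl).trans ?_))
  rw [one_pow, one_mul]
  have hG : ∏ i, ∑ a ∈ Finset.range (m + 1), (2 * c i) ^ a * a ! * l ^ a / a ! ≤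
      Real.exp (m : ℝ) := by
    calc _ ≤ ∏ i, Real.exp (4 * l * c i) := by
          refine Finset.prod_le_prod (fun i _ => Finset.sum_nonneg fun a _ => by
            have := hc i; positivity) fun i _ => ?_
          have hx0 : 0 ≤ 2 * c i * l := by have := hc i; positivity
          have hx : 2 * c i * l ≤ 1 / 2 := by
            rw [hl, ← mul_div_assoc, div_le_iff₀ (by positivity)]
            nlinarith [hcτ i, mul_le_mul_of_nonneg_right (hcτ i) hm0.le]
          have hs : ∑ a ∈ Finset.range (m + 1), (2 * c i) ^ a * a ! * l ^ a / a ! =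
              ∑ a ∈ Finset.range (m + 1), (2 * c i * l) ^ a :=
            Finset.sum_congr rfl fun a _ => by
              have : (a ! : ℝ) ≠ 0 := by positivity
              field_simp
              ring
          rw [hs]
          -- For `0 ≤ y ≤ 1/2`, `1 / (1 - y) ≤ 1 + 2y ≤ e^(2y)`; here `y = 2 c_i l`.
          have h2 : ∑ a ∈ Finset.range (m + 1), (2 * c i * l) ^ a ≤ 1 / (1 - 2 * c i * l) := by
            rw [le_div_iff₀ (by linarith), geom_sum_mul_neg]
            have : 0 ≤ (2 * c i * l) ^ (m + 1) := by positivity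
            linarith
          refine h2.trans ?_
          rw [div_le_iff₀ (by linarith)]
          have h3 := Real.add_one_le_exp (4 * l * c i)
          nlinarith
      _ = Real.exp (4 * l * T) := by
          rw [← Real.exp_sum, ← Finset.mul_sum]
      _ ≤ _ := by
          refine Real.exp_le_exp.2 ?_
          rw [hl, show 4 * (m / (4 * (T + m * τ))) * T = m * T / (T + m * τ) by field_simp,
            div_le_iff₀ (by positivity)]
          nlinarith [mul_pos hm0 hτ]
  calc (m ! : ℝ) / l ^ m * _ ≤ (m : ℝ) ^ m / l ^ m * Real.exp m := by
        have hm' : (m ! : ℝ) ≤ (m : ℝ) ^ m := by exact_mod_cast Nat.factorial_le_pow m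
        exact mul_le_mul (by gcongr) hG (Finset.prod_nonneg fun i _ => Finset.sum_nonneg
          fun a _ => by have := hc i; positivity) (by positivity)
    _ = _ := by
        rw [← div_pow, ← Real.exp_one_pow, ← mul_pow, hl]
        congr 1
        field_simp

/-! ### The quadratic form of the covariance matrix -/

section Matrix

variable {d : ℕ}

lemma matrixNorm_nonneg (S : Matrix (Fin d) (Fin d) ℝ) (u : EuclideanSpace ℝ (Fin d)) :
    0 ≤ matrixNorm S u := Real.sqrt_nonneg _

lemma opNorm_nonneg (S : Matrix (Fin d) (Fin d) ℝ) : 0 ≤ opNorm S := norm_nonneg _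

lemma matrixNorm_sq {S : Matrix (Fin d) (Fin d) ℝ} (hS : S.PosSemidef)
    (u : EuclideanSpace ℝ (Fin d)) :
    matrixNorm S u ^ 2 = inner ℝ u (Matrix.toEuclideanCLM (𝕜 := ℝ) S u) := by
  rw [matrixNorm, Real.sq_sqrt, Matrix.inner_toEuclideanCLM]
  simpa using hS.dotProduct_mulVec_nonneg u.ofLp

lemma toEuclideanCLM_eigenvectorBasis {S : Matrix (Fin d) (Fin d) ℝ} (hS : S.IsHermitian)
    (i : Fin d) : Matrix.toEuclideanCLM (𝕜 := ℝ) S (hS.eigenvectorBasis i) =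
      hS.eigenvalues i • hS.eigenvectorBasis i := by
  apply WithLp.ofLp_injective
  rw [Matrix.ofLp_toEuclideanCLM, hS.mulVec_eigenvectorBasis]
  simp

lemma eigenvalues_le_opNorm {S : Matrix (Fin d) (Fin d) ℝ} (hS : S.IsHermitian) (i : Fin d) :
    hS.eigenvalues i ≤ opNorm S := by
  have h := (Matrix.toEuclideanCLM (𝕜 := ℝ) S).le_opNorm (hS.eigenvectorBasis i)
  rw [toEuclideanCLM_eigenvectorBasis, norm_smul, hS.eigenvectorBasis.norm_eq_one, mul_one,
    mul_one] at h
  exact (le_abs_self _).trans h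

lemma measurable_matrixNorm (S : Matrix (Fin d) (Fin d) ℝ) : Measurable (matrixNorm S) := by
  have h : matrixNorm S =
      fun u => √(inner ℝ u (Matrix.toEuclideanCLM (𝕜 := ℝ) S u)) := by
    ext u; rw [matrixNorm, Matrix.inner_toEuclideanCLM]
  rw [h]
  fun_prop

/-- In an eigenbasis the Gaussian coordinates stay independent and standard, and the squared norm is
their weighted sum of squares: the weights are the eigenvalues, with sum `tr S` and maximum at most
`opNorm S`. -/
lemma lintegral_matrixNorm_pow_stdGaussian {S : Matrix (Fin d) (Fin d) ℝ} (hS : S.PosSemidef)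
    {m : ℕ} (hm : 1 ≤ m) :
    ∫⁻ x, ENNReal.ofReal (matrixNorm S x ^ (2 * m))
        ∂stdGaussian (EuclideanSpace ℝ (Fin d)) ≤
      ENNReal.ofReal ((4 * Real.exp 1 * (S.trace + m * opNorm S)) ^ m) := by
  rcases (opNorm_nonneg S).eq_or_lt with h0 | h0
  · have hS0 : S = 0 := by
      rw [opNorm, eq_comm, norm_eq_zero] at h0
      exact (map_eq_zero_iff _ (Matrix.toEuclideanCLM (𝕜 := ℝ) (n := Fin d)).injective).1 h0
    have : ∀ x, matrixNorm S x ^ (2 * m) = 0 := fun x => by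
      rw [hS0, matrixNorm]
      simp; omega
    simp [this]
  set b := hS.1.eigenvectorBasis with hb
  rw [stdGaussian_eq_map_pi_orthonormalBasis b, lintegral_map
    ((measurable_matrixNorm S).pow_const _).ennreal_ofReal (by fun_prop)]
  have hq : ∀ x : Fin d → ℝ, matrixNorm S (∑ i, x i • b i) ^ (2 * m) =
      (∑ i, hS.1.eigenvalues i * x i ^ 2) ^ m := fun x => by
    have hT : Matrix.toEuclideanCLM (𝕜 := ℝ) S (∑ i, x i • b i) =
        ∑ i, (x i * hS.1.eigenvalues i) • b i := by
      simp_rw [map_sum, map_smul, hb, toEuclideanCLM_eigenvectorBasis, smul_smul]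
    rw [pow_mul, matrixNorm_sq hS, hT, b.orthonormal.inner_sum]
    congr 1
    refine Finset.sum_congr rfl fun i _ => ?_
    simp only [conj_trivial]
    ring
  have htr : S.trace = ∑ i, hS.1.eigenvalues i := by
    simpa using hS.1.trace_eq_sum_eigenvalues
  simp_rw [hq, htr]
  exact lintegral_weighted_sq_pow_pi_gaussianReal _ hS.eigenvalues_nonneg
    (eigenvalues_le_opNorm hS.1) h0 hm

end Matrix

/-! ### Moments of products of marginals -/

section Marginals

variable {d : ℕ} {Ω : Type*} [MeasurableSpace Ω] {μ : Measure Ω} [IsProbabilityMeasure μ]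
  {Z : Ω → EuclideanSpace ℝ (Fin d)} {η : ℝ}

lemma HasSubexponentialMarginals.memLp (h : HasSubexponentialMarginals μ Z η)
    (hZ : AEMeasurable Z μ) (u : EuclideanSpace ℝ (Fin d)) (p : NNReal) :
    MemLp (fun ω => inner ℝ u (Z ω)) p μ := by
  have hm : AEStronglyMeasurable (fun ω => inner ℝ u (Z ω)) μ :=
    (AEMeasurable.const_inner hZ).aestronglyMeasurable
  have h1 : MemLp (fun ω => inner ℝ u (Z ω)) (ENNReal.ofReal (p + 1)) μ :=
    ⟨hm, (h u (p + 1) (by simp)).trans_lt ENNReal.ofReal_lt_top⟩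
  refine h1.mono_exponent ?_
  rw [← ENNReal.ofReal_coe_nnreal]
  exact ENNReal.ofReal_le_ofReal (by simp)

lemma HasSubexponentialMarginals.integrable_mul (h : HasSubexponentialMarginals μ Z η)
    (hZ : AEMeasurable Z μ) (u v : EuclideanSpace ℝ (Fin d)) :
    Integrable (fun ω => inner ℝ u (Z ω) * inner ℝ v (Z ω)) μ :=
  MemLp.integrable_mul (p := 2) (q := 2) (h.memLp hZ u 2) (h.memLp hZ v 2)

lemma HasSubexponentialMarginals.integral_mul (h : HasSubexponentialMarginals μ Z η)
    (hZ : AEMeasurable Z μ) (u v : EuclideanSpace ℝ (Fin d)) :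
    ∫ ω, inner ℝ u (Z ω) * inner ℝ v (Z ω) ∂μ =
      inner ℝ u (Matrix.toEuclideanCLM (𝕜 := ℝ) (secondMomentMatrix μ Z) v) := by
  have hint : ∀ i j, Integrable (fun ω => Z ω i * Z ω j) μ := fun i j => by
    simpa [EuclideanSpace.inner_single_left] using
      h.integrable_mul hZ (EuclideanSpace.single i 1) (EuclideanSpace.single j 1)
  have hexp : ∀ ω, inner ℝ u (Z ω) * inner ℝ v (Z ω) =
      ∑ i, ∑ j, u i * (Z ω i * Z ω j) * v j := fun ω => by
    simp only [PiLp.inner_apply, RCLike.inner_apply, conj_trivial, Finset.sum_mul_sum]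
    exact Finset.sum_congr rfl fun i _ => Finset.sum_congr rfl fun j _ => by ring
  simp_rw [hexp]
  rw [integral_finsetSum _ fun i _ => integrable_finsetSum _ fun j _ =>
    ((hint i j).const_mul _).mul_const _, Matrix.inner_toEuclideanCLM]
  simp only [dotProduct, Matrix.mulVec, secondMomentMatrix, Matrix.of_apply, Finset.mul_sum]
  refine Finset.sum_congr rfl fun i _ => ?_
  rw [integral_finsetSum _ fun j _ => ((hint i j).const_mul _).mul_const _]
  refine Finset.sum_congr rfl fun j _ => ?_
  rw [integral_mul_const, integral_const_mul]
  ring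

lemma HasSubexponentialMarginals.posSemidef (h : HasSubexponentialMarginals μ Z η)
    (hZ : AEMeasurable Z μ) : (secondMomentMatrix μ Z).PosSemidef := by
  refine Matrix.PosSemidef.of_dotProduct_mulVec_nonneg ?_ fun x => ?_
  · ext i j
    simp [secondMomentMatrix, mul_comm]
  · have := h.integral_mul hZ (WithLp.toLp 2 x) (WithLp.toLp 2 x)
    rw [Matrix.inner_toEuclideanCLM] at this
    rw [star_trivial, ← this]
    exact integral_nonneg fun ω => mul_self_nonneg _

/-- Central moments of the product of two marginals. -/
lemma HasSubexponentialMarginals.abs_integral_pow_le (h : HasSubexponentialMarginals μ Z η)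
    (hZ : AEMeasurable Z μ) (hη : 0 ≤ η) (u v : EuclideanSpace ℝ (Fin d)) (a : ℕ) :
    Integrable (fun ω => (inner ℝ u (Z ω) * inner ℝ v (Z ω) -
      inner ℝ u (Matrix.toEuclideanCLM (𝕜 := ℝ) (secondMomentMatrix μ Z) v)) ^ a) μ ∧
    |∫ ω, (inner ℝ u (Z ω) * inner ℝ v (Z ω) -
      inner ℝ u (Matrix.toEuclideanCLM (𝕜 := ℝ) (secondMomentMatrix μ Z) v)) ^ a ∂μ| ≤
      (matrixNorm (secondMomentMatrix μ Z) u * matrixNorm (secondMomentMatrix μ Z) v) ^ a *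
        if a = 1 then 0 else (8 * η ^ 2 * a ^ 2) ^ a := by
  set S := secondMomentMatrix μ Z with hS
  set c := inner ℝ u (Matrix.toEuclideanCLM (𝕜 := ℝ) S v) with hc
  have hci : ∫ ω, inner ℝ u (Z ω) * inner ℝ v (Z ω) ∂μ = c := h.integral_mul hZ u v
  have hI := h.integrable_mul hZ u v
  rcases eq_or_ne a 1 with rfl | ha1
  · simp only [pow_one, if_true, mul_zero]
    refine ⟨hI.sub (integrable_const _), ?_⟩
    rw [integral_sub hI (integrable_const _), hci]
    simp
  rcases Nat.eq_zero_or_pos a with rfl | ha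
  · simp
  rw [if_neg ha1]
  set f : Ω → ℝ := fun ω => inner ℝ u (Z ω) with hf
  set g : Ω → ℝ := fun ω => inner ℝ v (Z ω) with hg
  have hfm : AEStronglyMeasurable f μ := (h.memLp hZ u 2).1
  have hgm : AEStronglyMeasurable g μ := (h.memLp hZ v 2).1
  have ha' : (1 : ℝ) ≤ a := by exact_mod_cast ha
  have hbound : ∀ w : EuclideanSpace ℝ (Fin d),
      eLpNorm (fun ω => inner ℝ w (Z ω)) ((2 * a : ℕ) : ENNReal) μ ≤
        ENNReal.ofReal (η * (2 * a) * matrixNorm S w) := fun w => by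
    have := h w (2 * a) (by linarith)
    rwa [show ENNReal.ofReal (2 * a) = ((2 * a : ℕ) : ENNReal) by
      rw [← ENNReal.ofReal_natCast]; push_cast; rfl] at this
  have hu0 := matrixNorm_nonneg S u
  have hv0 := matrixNorm_nonneg S v
  set B : ℝ := 4 * η ^ 2 * a ^ 2 * (matrixNorm S u * matrixNorm S v) with hB
  have hB0 : 0 ≤ B := by positivity
  -- Cauchy–Schwarz: the `L^a` norm of the product is controlled by the two `L^(2a)` norms, each
  -- linear in `a`, hence the `a ^ 2`.
  have : ENNReal.HolderTriple ((2 * a : ℕ) : ENNReal) ((2 * a : ℕ) : ENNReal) (a : ENNReal) := by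
    refine ⟨?_⟩
    rw [Nat.cast_mul, Nat.cast_ofNat, ENNReal.mul_inv (by simp) (by simp), ← add_mul,
      ENNReal.inv_two_add_inv_two, one_mul]
  have hfg : eLpNorm (fun ω => f ω * g ω) a μ ≤ ENNReal.ofReal B := by
    have := eLpNorm_smul_le_mul_eLpNorm (p := ((2 * a : ℕ) : ENNReal))
      (q := ((2 * a : ℕ) : ENNReal)) (r := (a : ENNReal)) hgm hfm
    refine this.trans ((mul_le_mul' (hbound u) (hbound v)).trans_eq ?_)
    rw [← ENNReal.ofReal_mul (by positivity)]
    congr 1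
    rw [hB]; ring
  -- The subtracted constant is the mean of `f g`, so its size is at most the `L¹` norm and hence
  -- the `L^a` norm of `f g`; centering only doubles the bound.
  have hcB : eLpNorm (fun _ : Ω => c) a μ ≤ ENNReal.ofReal B := by
    rw [eLpNorm_const _ (by exact_mod_cast ha.ne') (IsProbabilityMeasure.ne_zero μ)]
    simp only [measure_univ, ENNReal.one_rpow, mul_one]
    rw [← hci]
    refine (enorm_integral_le_lintegral_enorm _).trans ?_
    rw [← eLpNorm_one_eq_lintegral_enorm]
    exact (eLpNorm_le_eLpNorm_of_exponent_le (by exact_mod_cast ha) hI.1).trans hfg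
  have hX : eLpNorm (fun ω => f ω * g ω - c) a μ ≤ ENNReal.ofReal (2 * B) := by
    refine (eLpNorm_sub_le hI.1 aestronglyMeasurable_const (by exact_mod_cast ha)).trans ?_
    rw [two_mul, ENNReal.ofReal_add hB0 hB0]
    exact add_le_add hfg hcB
  have hXm : MemLp (fun ω => f ω * g ω - c) a μ :=
    ⟨hI.1.sub aestronglyMeasurable_const, hX.trans_lt ENNReal.ofReal_lt_top⟩
  have hint : Integrable (fun ω => ‖f ω * g ω - c‖ ^ a) μ := hXm.integrable_norm_pow'
  refine ⟨?_, ?_⟩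
  · refine (integrable_norm_iff (hXm.1.pow a)).1 ?_
    simpa [norm_pow] using hint
  calc |∫ ω, (f ω * g ω - c) ^ a ∂μ| ≤ ∫ ω, ‖f ω * g ω - c‖ ^ a ∂μ := by
        simp only [← norm_pow]
        exact norm_integral_le_integral_norm (fun ω => (f ω * g ω - c) ^ a)
    _ ≤ (2 * B) ^ a := by
        have h1 := hXm.eLpNorm_eq_integral_rpow_norm (by exact_mod_cast ha.ne')
          (ENNReal.natCast_ne_top a)
        rw [h1] at hX
        have h2 := (ENNReal.ofReal_le_ofReal_iff (by positivity)).1 hX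
        simp only [ENNReal.toReal_natCast, Real.rpow_natCast] at h2
        have hn : 0 ≤ ∫ ω, ‖f ω * g ω - c‖ ^ a ∂μ := integral_nonneg fun ω => by positivity
        calc _ = ((∫ ω, ‖f ω * g ω - c‖ ^ a ∂μ) ^ ((a : ℝ)⁻¹)) ^ a :=
              (Real.rpow_inv_natCast_pow hn ha.ne').symm
          _ ≤ _ := by gcongr
    _ = _ := by rw [← mul_pow, hB]; congr 1; ring

end Marginals

/-- Truncated exponential generating function of the moments `(D a ^ 2) ^ a` of a centered
variable. -/
lemma sum_range_moment_le {D l : ℝ} (hD : 0 ≤ D) (hl : 0 ≤ l) {p : ℕ}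
    (hx : 8 * p * (Real.exp 1 * D * l) ≤ 1) :
    ∑ a ∈ Finset.range (p + 1), (if a = 1 then 0 else (D * (a : ℝ) ^ 2) ^ a) * l ^ a / a ! ≤
      Real.exp (32 * (Real.exp 1 * D * l) ^ 2) := by
  set x := Real.exp 1 * D * l with hxdef
  have hx0 : 0 ≤ x := by positivity
  -- Since `a ^ a / a! ≤ e ^ a`, the `a`-th term is at most `(a x) ^ a`, where `a x ≤ 1/8` because
  -- `a ≤ p`. The vanishing first moment lets two factors be kept aside, so the sum is `1 + O(x²)`
  -- instead of `1 + O(x)`; this produces the `√n` scale.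
  have hterm : ∀ a ∈ Finset.range (p + 1),
      (if a = 1 then 0 else (D * (a : ℝ) ^ 2) ^ a) * l ^ a / a ! ≤
        (if a = 0 then 1 else 0) + 16 * x ^ 2 * (1 / 2) ^ a := by
    intro a ha
    have hap : (a : ℝ) ≤ p := by exact_mod_cast Nat.lt_succ_iff.mp (Finset.mem_range.mp ha)
    match a with
    | 0 => simp; positivity
    | 1 => simp; positivity
    | b + 2 =>
      rw [if_neg (by omega), if_neg (by omega), zero_add]
      have he := Real.pow_div_factorial_le_exp ((b + 2 : ℕ) : ℝ) (by positivity) (b + 2)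
      have hpx : ((b + 2 : ℕ) : ℝ) * x ≤ 1 / 8 := by nlinarith
      -- The square of this growth, `4 ^ b`, is beaten by `(1/8) ^ b`, leaving a geometric series of
      -- ratio `1/2`.
      have hb : ((b + 2 : ℕ) : ℝ) ≤ 2 * 2 ^ b := by
        have : b + 1 ≤ 2 ^ b := Nat.lt_two_pow_self
        have h2 : b + 2 ≤ 2 * 2 ^ b := by omega
        exact_mod_cast h2
      set k : ℝ := ((b + 2 : ℕ) : ℝ) with hk
      have hk0 : 0 ≤ k := by positivity
      calc (D * k ^ 2) ^ (b + 2) * l ^ (b + 2) / (b + 2)!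
          = (D * k * l) ^ (b + 2) * (k ^ (b + 2) / (b + 2)!) := by ring
        _ ≤ (D * k * l) ^ (b + 2) * Real.exp k := by gcongr
        _ = (k * x) ^ (b + 2) := by
            rw [hk, ← Real.exp_one_pow, ← hk, ← mul_pow, hxdef]
            ring
        _ = (k * x) ^ 2 * (k * x) ^ b := by ring
        _ ≤ (2 * 2 ^ b * x) ^ 2 * (1 / 8) ^ b := by gcongr
        _ = 16 * x ^ 2 * (1 / 2) ^ (b + 2) := by
            have : (2 : ℝ) ^ b * 2 ^ b * (1 / 8) ^ b = (1 / 2) ^ b := by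
              rw [← mul_pow, ← mul_pow]; norm_num
            linear_combination 4 * x ^ 2 * this
  refine (Finset.sum_le_sum hterm).trans ?_
  rw [Finset.sum_add_distrib, ← Finset.mul_sum]
  have h1 : ∑ a ∈ Finset.range (p + 1), (if a = 0 then 1 else 0 : ℝ) = 1 := by simp
  have h2 : ∑ a ∈ Finset.range (p + 1), (1 / 2 : ℝ) ^ a ≤ 2 :=
    sum_geometric_two_le (p + 1)
  have h3 := Real.add_one_le_exp (32 * x ^ 2)
  nlinarith [sq_nonneg x]

/-! ### The operator norm through Gaussian averaging -/

section Norm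

variable {E : Type*} [NormedAddCommGroup E] [InnerProductSpace ℝ E] [FiniteDimensional ℝ E]
  [MeasurableSpace E] [BorelSpace E]

/-- The operator norm is controlled by the moments of the bilinear form at a pair of independent
standard Gaussian vectors. -/
lemma ofReal_opNorm_pow_le_lintegral_stdGaussian (A : E →L[ℝ] E) {m : ℕ} (hm : 1 ≤ m) :
    ENNReal.ofReal ((m ! * ‖A‖ ^ m) ^ 2) ≤
      ∫⁻ w, ENNReal.ofReal (inner ℝ w.1 (A w.2) ^ (2 * m))
        ∂((stdGaussian E).prod (stdGaussian E)) := by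
  have : CompleteSpace E := FiniteDimensional.complete ℝ E
  set c : ℝ := (((2 * m - 1)‼ : ℕ) : ℝ) with hc
  have hmc : (m ! : ℝ) ≤ c :=
    Nat.cast_le.2 (factorial_le_doubleFactorial_two_mul_sub_one m)
  have hm0 : (0 : ℝ) < m ! := by positivity
  have hc0 : 0 < c := hm0.trans_le hmc
  rw [lintegral_prod _ (by fun_prop)]
  have hin : ∀ u : E, ∫⁻ v, ENNReal.ofReal (inner ℝ u (A v) ^ (2 * m)) ∂stdGaussian E =
      ENNReal.ofReal (‖A.adjoint u‖ ^ (2 * m) * c) := fun u => by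
    simp_rw [← ContinuousLinearMap.adjoint_inner_left]
    exact lintegral_inner_pow_stdGaussian _ m
  simp only [hin]
  set J := ∫⁻ u, ENNReal.ofReal (‖A.adjoint u‖ ^ (2 * m) * c) ∂stdGaussian E with hJ
  -- For a unit vector `z`, `‖A* u‖ ≥ |⟨z, A* u⟩| = |⟨A z, u⟩|`, a one-dimensional Gaussian in `u`
  -- whose moment is explicit.
  have hz : ∀ z : E, ‖z‖ = 1 → ENNReal.ofReal (‖A z‖ ^ (2 * m) * c * c) ≤ J := fun z hz => by
    rw [ENNReal.ofReal_mul (by positivity), ← lintegral_inner_pow_stdGaussian,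
      ← lintegral_mul_const _ (by fun_prop)]
    refine lintegral_mono fun u => ?_
    rw [← ENNReal.ofReal_mul ((even_two_mul m).pow_nonneg _)]
    refine ENNReal.ofReal_le_ofReal (mul_le_mul_of_nonneg_right ?_ hc0.le)
    rw [← (even_two_mul m).pow_abs]
    refine pow_le_pow_left₀ (abs_nonneg _) ?_ _
    rw [← ContinuousLinearMap.adjoint_inner_right]
    simpa [hz] using abs_real_inner_le_norm z (A.adjoint u)
  rcases eq_or_ne J ⊤ with htop | htop
  · rw [htop]; exact le_top
  have hJ0 : 0 ≤ J.toReal := ENNReal.toReal_nonneg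
  have hA : ‖A‖ ≤ (J.toReal / c ^ 2) ^ (((2 * m : ℕ) : ℝ)⁻¹) := by
    refine A.opNorm_le_of_unit_norm (by positivity) fun z h1 => ?_
    have h2 := (ENNReal.ofReal_le_iff_le_toReal htop).1 (hz z h1)
    refine le_of_pow_le_pow_left₀ (n := 2 * m) (by omega) (by positivity) ?_
    rw [Real.rpow_inv_natCast_pow (by positivity) (by omega), le_div_iff₀ (by positivity)]
    linarith
  rw [ENNReal.ofReal_le_iff_le_toReal htop]
  have h3 := pow_le_pow_left₀ (norm_nonneg A) hA (2 * m)
  rw [Real.rpow_inv_natCast_pow (by positivity) (by omega), le_div_iff₀ (by positivity)] at h3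
  calc (m ! * ‖A‖ ^ m) ^ 2 = ‖A‖ ^ (2 * m) * (m ! : ℝ) ^ 2 := by ring
    _ ≤ ‖A‖ ^ (2 * m) * c ^ 2 := by gcongr
    _ ≤ _ := h3

end Norm

/-! ### Moments of the sample covariance error -/

lemma natCast_mul_inner_sampleCovariance_sub {d n : ℕ} (hn : n ≠ 0)
    (z : Fin n → EuclideanSpace ℝ (Fin d)) (S : Matrix (Fin d) (Fin d) ℝ)
    (u v : EuclideanSpace ℝ (Fin d)) :
    (n : ℝ) * inner ℝ u (Matrix.toEuclideanCLM (𝕜 := ℝ) (sampleCovariance z - S) v) =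
      ∑ i, (inner ℝ u (z i) * inner ℝ v (z i) -
        inner ℝ u (Matrix.toEuclideanCLM (𝕜 := ℝ) S v)) := by
  have hn' : (n : ℝ) ≠ 0 := by exact_mod_cast hn
  have h : ∀ i, inner ℝ u (z i) * inner ℝ v (z i) =
      inner ℝ u (Matrix.toEuclideanCLM (𝕜 := ℝ) (Matrix.vecMulVec (z i).ofLp (z i).ofLp) v) :=
    fun i => by
      rw [Matrix.inner_toEuclideanCLM, Matrix.vecMulVec_mulVec,
        EuclideanSpace.inner_eq_star_dotProduct, EuclideanSpace.inner_eq_star_dotProduct]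
      simp [dotProduct_comm, mul_comm]
  simp_rw [h]
  rw [Finset.sum_sub_distrib, ← inner_sum, ← _root_.sum_apply, ← map_sum, map_sub,
    sampleCovariance, map_smul, _root_.sub_apply, inner_sub_right,
    _root_.smul_apply, inner_smul_right]
  simp
  field_simp

section Copies

variable {d n : ℕ} {Ω₀ : Type*} [MeasurableSpace Ω₀] {μ₀ : Measure Ω₀} [IsProbabilityMeasure μ₀]
  {Z : Ω₀ → EuclideanSpace ℝ (Fin d)} {Ω : Type*} [MeasurableSpace Ω] {μ : Measure Ω}
  [IsProbabilityMeasure μ] {Zs : Fin n → Ω → EuclideanSpace ℝ (Fin d)} {η : ℝ}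

/-- Moments of the bilinear form of the sample covariance error, at a fixed pair of vectors. -/
lemma lintegral_inner_sampleCovariance_sub_pow_le (hn : n ≠ 0) (hind : iIndepFun Zs μ)
    (hid : ∀ i, IdentDistrib (Zs i) Z μ μ₀) (hZ : AEMeasurable Z μ₀) (hη : 0 < η)
    (h : HasSubexponentialMarginals μ₀ Z η) {m : ℕ} {l : ℝ} (hl : 0 < l)
    (hx : 8 * (2 * m : ℕ) * (Real.exp 1 * (8 * η ^ 2) * l) ≤ 1)
    (hnx : n * (Real.exp 1 * (8 * η ^ 2) * l) ^ 2 ≤ 2 * m) (u v : EuclideanSpace ℝ (Fin d)) :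
    ∫⁻ ω, ENNReal.ofReal ((n * inner ℝ u (Matrix.toEuclideanCLM (𝕜 := ℝ)
        (sampleCovariance (fun i => Zs i ω) - secondMomentMatrix μ₀ Z) v)) ^ (2 * m)) ∂μ ≤
      ENNReal.ofReal ((m ! * (2 * Real.exp 32 / l) ^ m) ^ 2) *
        (ENNReal.ofReal (matrixNorm (secondMomentMatrix μ₀ Z) u ^ (2 * m)) *
        ENNReal.ofReal (matrixNorm (secondMomentMatrix μ₀ Z) v ^ (2 * m))) := by
  set S := secondMomentMatrix μ₀ Z with hS
  simp_rw [natCast_mul_inner_sampleCovariance_sub hn]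
  set κ := inner ℝ u (Matrix.toEuclideanCLM (𝕜 := ℝ) S v) with hκ
  have hu0 := matrixNorm_nonneg S u
  have hv0 := matrixNorm_nonneg S v
  have hmeas : Measurable fun z : EuclideanSpace ℝ (Fin d) => inner ℝ u z * inner ℝ v z - κ := by
    fun_prop
  have hind' : iIndepFun (fun i ω => inner ℝ u (Zs i ω) * inner ℝ v (Zs i ω) - κ) μ :=
    hind.comp (fun _ z => inner ℝ u z * inner ℝ v z - κ) fun _ => hmeas
  have hid' : ∀ i (a : ℕ), IdentDistrib
      (fun ω => (inner ℝ u (Zs i ω) * inner ℝ v (Zs i ω) - κ) ^ a)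
      (fun ω => (inner ℝ u (Z ω) * inner ℝ v (Z ω) - κ) ^ a) μ μ₀ :=
    fun i a => (hid i).comp (hmeas.pow_const a)
  obtain ⟨hI, hB⟩ := abs_integral_sum_pow_le hind'
    (fun i a => (hid' i a).integrable_iff.2 (h.abs_integral_pow_le hZ hη.le u v a).1)
    (N := fun _ a => if a = 1 then 0 else (8 * η ^ 2 * (a : ℝ) ^ 2) ^ a)
    (fun _ a => by split_ifs <;> positivity) (mul_nonneg hu0 hv0)
    (fun i a => by
      rw [(hid' i a).integral_eq]; exact (h.abs_integral_pow_le hZ hη.le u v a).2)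
    hl (2 * m) Finset.univ
  rw [← ofReal_integral_eq_lintegral_ofReal (hI _)
    (Filter.Eventually.of_forall fun ω => (even_two_mul m).pow_nonneg _),
    ← ENNReal.ofReal_mul (by positivity), ← ENNReal.ofReal_mul (by positivity)]
  refine ENNReal.ofReal_le_ofReal ((le_abs_self _).trans ((hB _ le_rfl).trans ?_))
  rw [Finset.prod_const, Finset.card_univ, Fintype.card_fin]
  have hG := sum_range_moment_le (by positivity) hl.le hx
  have hG0 : 0 ≤ ∑ a ∈ Finset.range (2 * m + 1),
      (if a = 1 then 0 else (8 * η ^ 2 * (a : ℝ) ^ 2) ^ a) * l ^ a / a ! :=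
    Finset.sum_nonneg fun a _ => by split_ifs <;> positivity
  have hGn := pow_le_pow_left₀ hG0 hG n
  rw [← Real.exp_nat_mul] at hGn
  -- By `hnx` the `n` generating functions together cost only a constant to the power `2m`.
  have hexp : Real.exp (n * (32 * (Real.exp 1 * (8 * η ^ 2) * l) ^ 2)) ≤
      (Real.exp 32 ^ m) ^ 2 := by
    rw [← pow_mul, ← Real.exp_nat_mul]
    refine Real.exp_le_exp.2 ?_
    push_cast
    linarith
  -- The factorial is put in the form `(m!) ^ 2` in order to cancel against the Gaussian lower bound
  -- for the operator norm.
  have hfac : ((2 * m)! : ℝ) ≤ (2 ^ m * m !) ^ 2 := by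
    have h1 := Nat.choose_mul_factorial_mul_factorial (n := 2 * m) (k := m) (by omega)
    have h2 : (2 * m).choose m ≤ 2 ^ (2 * m) := Nat.choose_le_two_pow _ _
    have h3 : (2 * m)! ≤ (2 ^ m * m !) ^ 2 := by
      rw [← h1, show 2 * m - m = m by omega]
      calc _ ≤ 2 ^ (2 * m) * m ! * m ! := by gcongr
        _ = _ := by ring
    exact_mod_cast h3
  calc (matrixNorm S u * matrixNorm S v) ^ (2 * m) * ((2 * m)! / l ^ (2 * m)) * _
      ≤ (matrixNorm S u * matrixNorm S v) ^ (2 * m) * ((2 ^ m * m !) ^ 2 / l ^ (2 * m)) *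
          (Real.exp 32 ^ m) ^ 2 := by
        have := hGn.trans hexp
        gcongr
    _ = _ := by
        rw [div_pow, mul_pow (2 : ℝ) (Real.exp 32), mul_pow, mul_pow]
        field_simp
        ring

/-- Moments of the operator norm of the sample covariance error. -/
lemma lintegral_opNorm_sampleCovariance_sub_pow_le (hn : n ≠ 0) (hind : iIndepFun Zs μ)
    (hid : ∀ i, IdentDistrib (Zs i) Z μ μ₀) (hZ : AEMeasurable Z μ₀) (hη : 0 < η)
    (h : HasSubexponentialMarginals μ₀ Z η) {m : ℕ} (hm : 1 ≤ m) {l : ℝ} (hl : 0 < l)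
    (hx : 8 * (2 * m : ℕ) * (Real.exp 1 * (8 * η ^ 2) * l) ≤ 1)
    (hnx : n * (Real.exp 1 * (8 * η ^ 2) * l) ^ 2 ≤ 2 * m) :
    ∫⁻ ω, ENNReal.ofReal ((n * opNorm (sampleCovariance (fun i => Zs i ω) -
        secondMomentMatrix μ₀ Z)) ^ (2 * m)) ∂μ ≤
      ENNReal.ofReal ((8 * Real.exp 33 * ((secondMomentMatrix μ₀ Z).trace +
        m * opNorm (secondMomentMatrix μ₀ Z)) / l) ^ (2 * m)) := by
  set S := secondMomentMatrix μ₀ Z with hS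
  have hpsd : S.PosSemidef := h.posSemidef hZ
  have hf0 : (0 : ℝ) < m ! := by positivity
  have hfE : ENNReal.ofReal ((m ! : ℝ) ^ 2) ≠ 0 := by
    rw [Ne, ENNReal.ofReal_eq_zero, not_le]; positivity
  have hstep : ∀ ω, ENNReal.ofReal ((m ! : ℝ) ^ 2) * ENNReal.ofReal
      ((n * opNorm (sampleCovariance (fun i => Zs i ω) - S)) ^ (2 * m)) ≤
      ∫⁻ w, ENNReal.ofReal ((n * inner ℝ w.1 (Matrix.toEuclideanCLM (𝕜 := ℝ)
        (sampleCovariance (fun i => Zs i ω) - S) w.2)) ^ (2 * m))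
        ∂((stdGaussian (EuclideanSpace ℝ (Fin d))).prod
          (stdGaussian (EuclideanSpace ℝ (Fin d)))) := fun ω => by
    have h1 := ofReal_opNorm_pow_le_lintegral_stdGaussian ((n : ℝ) •
      Matrix.toEuclideanCLM (𝕜 := ℝ) (sampleCovariance (fun i => Zs i ω) - S)) hm
    rw [norm_smul, Real.norm_natCast] at h1
    simp only [_root_.smul_apply, inner_smul_right] at h1
    refine le_trans (le_of_eq ?_) h1
    rw [← ENNReal.ofReal_mul (by positivity), opNorm]
    congr 1
    ring
  have hZs : ∀ i, AEMeasurable (Zs i) μ := fun i => (hid i).aemeasurable_fst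
  have hjoint : AEMeasurable (Function.uncurry fun ω (w : EuclideanSpace ℝ (Fin d) ×
      EuclideanSpace ℝ (Fin d)) => ENNReal.ofReal ((n * inner ℝ w.1 (Matrix.toEuclideanCLM (𝕜 := ℝ)
        (sampleCovariance (fun i => Zs i ω) - S) w.2)) ^ (2 * m)))
      (μ.prod ((stdGaussian (EuclideanSpace ℝ (Fin d))).prod
        (stdGaussian (EuclideanSpace ℝ (Fin d))))) := by
    simp_rw [natCast_mul_inner_sampleCovariance_sub hn]
    simp only [Function.uncurry_def]
    have := fun i => (hZs i).comp_fst (ν := (stdGaussian (EuclideanSpace ℝ (Fin d))).prod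
        (stdGaussian (EuclideanSpace ℝ (Fin d))))
    fun_prop
  have hG := lintegral_matrixNorm_pow_stdGaussian hpsd hm
  have hT : 0 ≤ 4 * Real.exp 1 * (S.trace + m * opNorm S) := by
    have := hpsd.trace_nonneg
    have := opNorm_nonneg S
    positivity
  have hmN := ((measurable_matrixNorm S).pow_const (2 * m)).ennreal_ofReal
  refine (ENNReal.mul_le_mul_iff_right hfE ENNReal.ofReal_ne_top).1 ?_
  rw [← lintegral_const_mul' _ _ ENNReal.ofReal_ne_top]
  refine (lintegral_mono hstep).trans ?_
  rw [lintegral_lintegral_swap hjoint]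
  have hw := fun w : EuclideanSpace ℝ (Fin d) × EuclideanSpace ℝ (Fin d) =>
    lintegral_inner_sampleCovariance_sub_pow_le hn hind hid hZ hη h hl hx hnx w.1 w.2
  rw [← hS] at hw
  generalize hK : ENNReal.ofReal ((m ! * (2 * Real.exp 32 / l) ^ m) ^ 2) = K at hw
  refine (lintegral_mono hw).trans ?_
  rw [lintegral_const_mul' _ _ (hK ▸ ENNReal.ofReal_ne_top),
    lintegral_prod_mul hmN.aemeasurable hmN.aemeasurable]
  refine (mul_le_mul_right (mul_le_mul' hG hG) _).trans_eq ?_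
  rw [← hK, ← ENNReal.ofReal_mul (by positivity), ← ENNReal.ofReal_mul (by positivity),
    ← ENNReal.ofReal_mul (by positivity)]
  congr 1
  have hx33 : 8 * Real.exp 33 * (S.trace + m * opNorm S) / l =
      2 * Real.exp 32 / l * (4 * Real.exp 1 * (S.trace + m * opNorm S)) := by
    rw [show (33 : ℝ) = 32 + 1 by norm_num, Real.exp_add]
    ring
  rw [hx33]
  generalize 2 * Real.exp 32 / l = a, 4 * Real.exp 1 * (S.trace + m * opNorm S) = b
  ring

end Copies

/-! ### Deviation bounds -/

/-- **Chernoff bound by moments**: a variable whose `p`-th moment is at most `K ^ p` exceeds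
`e K` with probability at most `e ^ (-p)`. -/
lemma measure_lt_le_exp_neg_of_lintegral_pow_le {Ω : Type*} [MeasurableSpace Ω] {μ : Measure Ω}
    {Y : Ω → ℝ} (hY : AEMeasurable Y μ) {K : ℝ} (hK : 0 ≤ K) {p : ℕ} (hp : p ≠ 0)
    (h : ∫⁻ ω, ENNReal.ofReal (Y ω ^ p) ∂μ ≤ ENNReal.ofReal (K ^ p)) :
    μ {ω | Real.exp 1 * K < Y ω} ≤ ENNReal.ofReal (Real.exp (-p)) := by
  have hm : AEMeasurable (fun ω => ENNReal.ofReal (Y ω ^ p)) μ := (hY.pow_const p).ennreal_ofReal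
  rcases hK.eq_or_lt with rfl | hK0
  · rw [zero_pow hp, ENNReal.ofReal_zero, nonpos_iff_eq_zero, lintegral_eq_zero_iff' hm] at h
    refine (measure_mono_null (fun ω hω => ?_) h).le.trans zero_le
    simp only [mul_zero, Set.mem_ofPred_eq] at hω
    simp [pow_pos hω p]
  · have hε : ENNReal.ofReal ((Real.exp 1 * K) ^ p) ≠ 0 := by
      rw [Ne, ENNReal.ofReal_eq_zero, not_le]; positivity
    have hsub : {ω | Real.exp 1 * K < Y ω} ⊆
        {ω | ENNReal.ofReal ((Real.exp 1 * K) ^ p) ≤ ENNReal.ofReal (Y ω ^ p)} := fun ω hω =>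
      ENNReal.ofReal_le_ofReal (pow_le_pow_left₀ (by positivity) (le_of_lt hω) p)
    refine (measure_mono hsub).trans
      ((meas_ge_le_lintegral_div hm hε ENNReal.ofReal_ne_top).trans ?_)
    refine ENNReal.div_le_of_le_mul (h.trans_eq ?_)
    rw [← ENNReal.ofReal_mul (by positivity)]
    congr 1
    rw [mul_pow, Real.exp_one_pow, ← mul_assoc, ← Real.exp_add]
    simp

lemma one_sub_exp_neg_le_measureReal {Ω : Type*} [MeasurableSpace Ω] {μ : Measure Ω}
    [IsProbabilityMeasure μ] {Y : Ω → ℝ} {K R t : ℝ} (hKR : K ≤ R)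
    (h : μ {ω | K < Y ω} ≤ ENNReal.ofReal (Real.exp (-t))) :
    1 - Real.exp (-t) ≤ μ.real {ω | Y ω ≤ R} := by
  have h1 : μ.real {ω | K < Y ω} ≤ Real.exp (-t) :=
    ENNReal.toReal_le_of_le_ofReal (Real.exp_nonneg _) h
  have h2 : μ.real Set.univ ≤ μ.real ({ω | Y ω ≤ R} ∪ {ω | K < Y ω}) :=
    measureReal_mono fun ω _ => by
      rcases le_or_gt (Y ω) K with h | h
      · exact Or.inl (h.trans hKR)
      · exact Or.inr h
  have h3 := measureReal_union_le (μ := μ) {ω | Y ω ≤ R} {ω | K < Y ω}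
  rw [probReal_univ] at h2
  linarith

/-- Deviation of the sample covariance matrix at confidence level `s`. -/
lemma measure_lt_opNorm_sampleCovariance_sub_le {d n : ℕ} {Ω₀ : Type*} [MeasurableSpace Ω₀]
    {μ₀ : Measure Ω₀} [IsProbabilityMeasure μ₀] {Z : Ω₀ → EuclideanSpace ℝ (Fin d)} {Ω : Type*}
    [MeasurableSpace Ω] {μ : Measure Ω} [IsProbabilityMeasure μ]
    {Zs : Fin n → Ω → EuclideanSpace ℝ (Fin d)} {η : ℝ} (hn : n ≠ 0) (hind : iIndepFun Zs μ)
    (hid : ∀ i, IdentDistrib (Zs i) Z μ μ₀) (hZ : AEMeasurable Z μ₀) (hη : 0 < η)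
    (h : HasSubexponentialMarginals μ₀ Z η) {s : ℝ} (hs : 1 ≤ s) :
    μ {ω | 4096 * Real.exp 35 * (η ^ 2 * opNorm (secondMomentMatrix μ₀ Z) *
        ((effectiveRank (secondMomentMatrix μ₀ Z) + s) * (s + √(n / s)) / n)) <
      opNorm (sampleCovariance (fun i => Zs i ω) - secondMomentMatrix μ₀ Z)} ≤
      ENNReal.ofReal (Real.exp (-s)) := by
  set S := secondMomentMatrix μ₀ Z with hS
  have hpsd : S.PosSemidef := h.posSemidef hZ
  have hσ := opNorm_nonneg S
  have htr : S.trace = effectiveRank S * opNorm S := by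
    rcases hσ.eq_or_lt with h0 | h0
    · have hS0 : S = 0 := by
        rw [opNorm, eq_comm, norm_eq_zero] at h0
        exact (map_eq_zero_iff _ (Matrix.toEuclideanCLM (𝕜 := ℝ) (n := Fin d)).injective).1 h0
      rw [← h0, hS0]; simp
    · rw [effectiveRank, div_mul_cancel₀ _ h0.ne']
  have hr : 0 ≤ effectiveRank S := div_nonneg hpsd.trace_nonneg hσ
  set r := effectiveRank S with hrdef
  set σ := opNorm S with hσdef
  have hn0 : (0 : ℝ) < n := by exact_mod_cast Nat.pos_of_ne_zero hn
  have hs0 : 0 < s := by linarith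
  set m := ⌈s⌉₊ with hm
  have hsm : s ≤ m := Nat.le_ceil s
  have hms : (m : ℝ) ≤ 2 * s := by
    have := Nat.ceil_lt_add_one hs0.le
    linarith
  have hm1 : 1 ≤ m := Nat.one_le_ceil_iff.2 hs0
  have hm0 : (0 : ℝ) < m := by exact_mod_cast hm1
  -- the scale at which the generating function is evaluated
  set y : ℝ := 16 * m + √(n / m) with hy
  have hy0 : 0 < y := by positivity
  set D : ℝ := Real.exp 1 * (8 * η ^ 2) with hD
  have hD0 : 0 < D := by positivity
  set l : ℝ := 1 / (D * y) with hl
  have hl0 : 0 < l := by positivity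
  -- The two summands of `y` serve the two constraints on `l`: `y ≥ 16 m` gives `hx`, and `y ≥
  -- √(n/m)` gives `hnx`.
  have hDl : D * l = 1 / y := by rw [hl]; field_simp
  have hx : 8 * (2 * m : ℕ) * (D * l) ≤ 1 := by
    rw [hDl, mul_one_div, div_le_one hy0, hy]
    push_cast
    have := Real.sqrt_nonneg (n / m : ℝ)
    linarith
  have hnx : n * (D * l) ^ 2 ≤ 2 * m := by
    have h1 : (n / m : ℝ) ≤ y ^ 2 := by
      calc (n / m : ℝ) = √(n / m) ^ 2 := (Real.sq_sqrt (by positivity)).symm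
        _ ≤ y ^ 2 := by gcongr; rw [hy]; linarith
    rw [hDl, div_pow, one_pow, mul_one_div, div_le_iff₀ (by positivity)]
    rw [div_le_iff₀ hm0] at h1
    nlinarith [mul_nonneg hm0.le (sq_nonneg y)]
  have hmom := lintegral_opNorm_sampleCovariance_sub_pow_le hn hind hid hZ hη h hm1 hl0 hx hnx
  rw [← hS, htr, ← add_mul] at hmom
  have hYm : AEMeasurable (fun ω => n * opNorm (sampleCovariance (fun i => Zs i ω) - S)) μ := by
    have hc : Measurable fun z : Fin n → EuclideanSpace ℝ (Fin d) =>
        (n : ℝ) * opNorm (sampleCovariance z - S) := by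
      refine Continuous.measurable ?_
      have h1 : Continuous (Matrix.toEuclideanCLM (𝕜 := ℝ) (n := Fin d)) :=
        LinearMap.continuous_of_finiteDimensional
          (Matrix.toEuclideanCLM (𝕜 := ℝ) (n := Fin d)).toAlgEquiv.toLinearMap
      have h2 : Continuous fun z : Fin n → EuclideanSpace ℝ (Fin d) => sampleCovariance z - S := by
        unfold sampleCovariance
        fun_prop
      unfold opNorm
      exact continuous_const.mul (h1.comp h2).norm
    exact hc.comp_aemeasurable (aemeasurable_pi_lambda _ fun i => (hid i).aemeasurable_fst)
  have htail := measure_lt_le_exp_neg_of_lintegral_pow_le hYm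
    (K := 8 * Real.exp 33 * ((r + m) * σ) / l) (by positivity) (p := 2 * m) (by omega) hmom
  refine (measure_mono fun ω hω => ?_).trans (htail.trans (ENNReal.ofReal_le_ofReal
    (Real.exp_le_exp.2 ?_)))
  · simp only [Set.mem_ofPred_eq] at hω ⊢
    rw [← div_lt_iff₀' hn0]
    refine lt_of_le_of_lt ?_ hω
    have hsq : √(n / m : ℝ) ≤ √(n / s) := Real.sqrt_le_sqrt (by gcongr)
    have hy' : y ≤ 32 * (s + √(n / s)) := by
      have := Real.sqrt_nonneg (n / s : ℝ)
      rw [hy]; linarith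
    have hrm : r + m ≤ 2 * (r + s) := by linarith
    calc Real.exp 1 * (8 * Real.exp 33 * ((r + m) * σ) / l) / n
        = 64 * Real.exp 35 * (η ^ 2 * σ * ((r + m) * y / n)) := by
          rw [hl, hD, show (35 : ℝ) = 33 + 1 + 1 by norm_num, Real.exp_add, Real.exp_add]
          field_simp
          ring
      _ ≤ 64 * Real.exp 35 * (η ^ 2 * σ * ((2 * (r + s)) * (32 * (s + √(n / s))) / n)) := by
          gcongr
      _ = 4096 * Real.exp 35 * (η ^ 2 * σ * ((r + s) * (s + √(n / s)) / n)) := by ring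
  · push_cast
    linarith

/-- Deviation of the sample covariance matrix, with a prescribed upper bound on the error. -/
lemma one_sub_exp_neg_le_measureReal_opNorm_sampleCovariance_sub {d n : ℕ} {Ω₀ : Type*}
    [MeasurableSpace Ω₀] {μ₀ : Measure Ω₀} [IsProbabilityMeasure μ₀]
    {Z : Ω₀ → EuclideanSpace ℝ (Fin d)} {Ω : Type*} [MeasurableSpace Ω] {μ : Measure Ω}
    [IsProbabilityMeasure μ] {Zs : Fin n → Ω → EuclideanSpace ℝ (Fin d)} {η : ℝ} (hn : n ≠ 0)
    (hind : iIndepFun Zs μ) (hid : ∀ i, IdentDistrib (Zs i) Z μ μ₀) (hη : 0 < η)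
    (h : HasSubexponentialMarginals μ₀ Z η) {s t M : ℝ} (hs : 1 ≤ s) (hts : t ≤ s)
    (hM : (effectiveRank (secondMomentMatrix μ₀ Z) + s) * (s + √(n / s)) / n ≤ 4 * M) :
    1 - Real.exp (-t) ≤ μ.real {ω |
      opNorm (sampleCovariance (fun i => Zs i ω) - secondMomentMatrix μ₀ Z) ≤
        16384 * Real.exp 35 * (η ^ 2 * opNorm (secondMomentMatrix μ₀ Z) * M)} := by
  have hZ : AEMeasurable Z μ₀ := (hid ⟨0, Nat.pos_of_ne_zero hn⟩).aemeasurable_snd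
  have hσ := opNorm_nonneg (secondMomentMatrix μ₀ Z)
  refine one_sub_exp_neg_le_measureReal ?_
    ((measure_lt_opNorm_sampleCovariance_sub_le hn hind hid hZ hη h hs).trans
      (ENNReal.ofReal_le_ofReal (Real.exp_le_exp.2 (neg_le_neg hts))))
  calc _ ≤ 4096 * Real.exp 35 * (η ^ 2 * opNorm (secondMomentMatrix μ₀ Z) * (4 * M)) := by
        gcongr
    _ = _ := by ring

/-! ### The two regimes of the effective rank -/

theorem mainTheorem4 :
    ∃ C : ℝ, 0 < C ∧
      ∀ (d n : ℕ) (_ : 1 ≤ n)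
        (Ω₀ : Type*) [MeasurableSpace Ω₀] (μ₀ : Measure Ω₀) [IsProbabilityMeasure μ₀]
        (Z : Ω₀ → EuclideanSpace ℝ (Fin d))
        (Ω : Type*) [MeasurableSpace Ω] (μ : Measure Ω) [IsProbabilityMeasure μ]
        (Zs : Fin n → Ω → EuclideanSpace ℝ (Fin d))
        (S : Matrix (Fin d) (Fin d) ℝ) (r η t : ℝ),
        -- `Z₁, …, Zₙ` are independent copies of `Z`
        iIndepFun Zs μ →
        (∀ i, IdentDistrib (Zs i) Z μ μ₀) →
        -- `Z` is centered, with covariance matrix `S` of effective rank `r`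
        ∫ ω, Z ω ∂μ₀ = 0 →
        S = secondMomentMatrix μ₀ Z →
        r = effectiveRank S →
        1 ≤ η →
        HasSubexponentialMarginals μ₀ Z η →
        0 ≤ t →
        (r ≤ (n : ℝ) ^ (1 / 3 : ℝ) →
          1 - Real.exp (-t) ≤ μ.real {ω |
            opNorm (sampleCovariance (fun i => Zs i ω) - S) ≤
              C * (η ^ 2 * opNorm S *
                max ((r + t + Real.log 8) ^ 2 / (n : ℝ))
                  (((r + t + Real.log 8) / (n : ℝ)) ^ (1 / 2 : ℝ)))}) ∧
        ((n : ℝ) ^ (1 / 3 : ℝ) < r →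
          1 - Real.exp (-t) ≤ μ.real {ω |
            opNorm (sampleCovariance (fun i => Zs i ω) - S) ≤
              C * (η ^ 2 * opNorm S *
                max (((n : ℝ) ^ (1 / 3 : ℝ) + t + Real.log 8) ^ 2 / (n : ℝ))
                  (r * ((n : ℝ) ^ (1 / 3 : ℝ) + t + Real.log 8) / (n : ℝ)))}) := by
  refine ⟨16384 * Real.exp 35, by positivity, ?_⟩
  intro d n hn Ω₀ _ μ₀ _ Z Ω _ μ _ Zs S r η t hind hid _ hS hr hη h ht
  subst hS hr
  have hn' : n ≠ 0 := by omega
  have hn0 : (0 : ℝ) < n := by exact_mod_cast hn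
  have hη0 : 0 < η := by linarith
  have hZ : AEMeasurable Z μ₀ := (hid ⟨0, hn⟩).aemeasurable_snd
  have hr0 : 0 ≤ effectiveRank (secondMomentMatrix μ₀ Z) :=
    div_nonneg (h.posSemidef hZ).trace_nonneg (opNorm_nonneg _)
  -- The term `log 8` serves to make the confidence level `s` at least `1`.
  have hlog : 1 ≤ Real.log 8 := by
    rw [Real.le_log_iff_exp_le (by norm_num)]
    linarith [Real.exp_one_lt_d9]
  set r := effectiveRank (secondMomentMatrix μ₀ Z) with hr
  constructor
  · intro _
    set s := r + t + Real.log 8 with hs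
    have hs1 : 1 ≤ s := by linarith
    have hs0 : 0 < s := by linarith
    refine one_sub_exp_neg_le_measureReal_opNorm_sampleCovariance_sub hn' hind hid hη0 h
      hs1 (by linarith) ?_
    rw [← hr, ← Real.sqrt_eq_rpow]
    -- As `r ≤ s`, the error is at most `2 s (s + √(n/s)) / n`, whose second part becomes the
    -- square-root term.
    have hsq : s * √(n / s) / n = √(s / n) := by
      rw [Real.sqrt_div hn0.le, Real.sqrt_div hs0.le]
      have h1 := Real.sqrt_pos.2 hs0
      have h2 := Real.sqrt_pos.2 hn0
      rw [div_eq_div_iff hn0.ne' h2.ne', mul_div_assoc', div_mul_eq_mul_div,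
        div_eq_iff h1.ne']
      calc s * √n * √n = s * (√n * √n) := by ring
        _ = (√s * √s) * n := by rw [Real.mul_self_sqrt hn0.le, Real.mul_self_sqrt hs0.le]
        _ = _ := by ring
    calc (r + s) * (s + √(n / s)) / n ≤ (s + s) * (s + √(n / s)) / n := by
          gcongr
          linarith
      _ = 2 * (s ^ 2 / n) + 2 * (s * √(n / s) / n) := by ring
      _ ≤ _ := by
          rw [hsq]
          linarith [le_max_left (s ^ 2 / n) √(s / n), le_max_right (s ^ 2 / n) √(s / n)]
  · intro _
    have hroot : ((n : ℝ) ^ (1 / 3 : ℝ)) ^ 3 = n := by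
      have := Real.rpow_inv_natCast_pow hn0.le (n := 3) (by norm_num)
      rwa [← one_div, Nat.cast_ofNat] at this
    set q := (n : ℝ) ^ (1 / 3 : ℝ) with hq
    have hq0 : 0 ≤ q := by positivity
    set s := q + t + Real.log 8 with hs
    have hs1 : 1 ≤ s := by linarith
    have hs0 : 0 < s := by linarith
    refine one_sub_exp_neg_le_measureReal_opNorm_sampleCovariance_sub hn' hind hid hη0 h
      hs1 (by linarith) ?_
    rw [← hr]
    -- The cube root of `n` is the threshold at which `√(n/s)` falls below `s`: `s ≥ n^(1/3)` means
    -- `n ≤ s³`.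
    have hsq : √(n / s) ≤ s := by
      refine Real.sqrt_le_iff.2 ⟨hs0.le, ?_⟩
      rw [div_le_iff₀ hs0, ← hroot, ← pow_succ]
      exact pow_le_pow_left₀ hq0 (by linarith) 3
    calc (r + s) * (s + √(n / s)) / n ≤ (r + s) * (s + s) / n := by gcongr
      _ = 2 * (s ^ 2 / n) + 2 * (r * s / n) := by ring
      _ ≤ _ := by
          linarith [le_max_left (s ^ 2 / n) (r * s / n), le_max_right (s ^ 2 / n) (r * s / n)]
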